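/- Let $f,g:\mathbb R^{d_x}\times\mathbb R^{d_y}\to\mathbb R$, $\mu>0$, $\bar\sigma>0$, and $l_f,L_f,L_g,\rho_f,\rho_g\ge 0$ be such that: (1) for every $0\le\sigma\le\bar\sigma$ and every $x$, the function $h=\sigma f(x,\cdot)+g(x,\cdot)$ attains its minimum $h^*$ and is $\mu$-P{\L}, i.e. $2\mu(h(y)-h^*)\le\|\nabla h(y)\|^2$ for all $y$; (2) $f$ is $l_f$-Lipschitz with $L_f$-Lipschitz gradient and $g$ has $L_g$-Lipschitz gradient; (3) $f$ and $g$ have $\rho_f$- and $\rho_g$-Lipschitz Hessians, respectively. Assume moreover that $g(x,\cdot)$ is not constant for at least one $x$. Fix $x_0,y_0,z_0$, $a_0>0$, $\alpha>1$, $L_{0,1}>0$, $L_{0,2}>0$. The subsolver AC-GM$(h,u^0,\alpha,L_0,\delta)$ starts with $k=0$ and, while $\|\nabla h(u^k)\|>\delta$, sets $\gamma_{k+1}=\max\{L_0,\dots,L_k\}$, $u^{k+1}=u^k-\frac{1}{\alpha\gamma_{k+1}}\nabla h(u^k)$, $L_{k+1}=2\big(h(u^{k+1})-h(u^k)-\langle\nabla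 h(u^k),u^{k+1}-u^k\rangle\big)/\|u^{k+1}-u^k\|^2$, and $k\leftarrow k+1$; it returns the last $u^k$ and the number $k$ of iterations. For a tolerance $\epsilon>0$ put $\sigma=\epsilon$ and $\epsilon_z=\epsilon_y=\epsilon^2$. The outer algorithm computes for $t=0,1,2,\dots$: $(z_t^{K_t},K_t)$ by AC-GM$(g(x_t,\cdot),z_t^0,\alpha,L_{0,1},\epsilon_z)$ and $(y_t^{N_t},N_t)$ by AC-GM$(\sigma f(x_t,\cdot)+g(x_t,\cdot),y_t^0,\alpha,L_{0,2},\epsilon_y)$, where $z_0^0=z_0$, $y_0^0=y_0$ and $z_t^0=z_{t-1}^{K_{t-1}}$, $y_t^0=y_{t-1}^{N_{t-1}}$ for $t\ge1$; then $v_t=\nabla_xf(x_t,y_t^{N_t})+\big(\nabla_xg(x_t,y_t^{N_t})-\nabla_xg(x_t,z_t^{K_t})\big)/\sigma$, $a_{t+1}^2=a_t^2+\|v_t\|^2$ (with $a_{t+1}>0$), $x_{t+1}=x_t-v_t/a_{t+1}$. For $L_0,L>0$ let $p(L_0,L)=\frac{\mu(\alpha-1)}{2\alpha^2\max\{L_0,L\}}$,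 $\bar C(L_0,L)=\max\big\{\frac{L^3}{\mu\alpha^2L_0^2},\frac{L^2}{\mu\alpha^2L_0},\frac{\mu L}{\alpha^2L_0^2},\frac{\mu}{\alpha^2L_0}\big\}$, $m(L_0,L)=\big\lceil\log_{(\alpha+1)/2}\frac{\max\{L_0,L\}}{L_0}\big\rceil$, $C(L_0,L)=\big(\frac{1+\bar C(L_0,L)}{1-p(L_0,L)}\big)^{m(L_0,L)}$. Let $L_\sigma:=L_f+L_g$, $p_g=p(L_{0,1},L_g)$ and $p_\sigma=p(L_{0,2},L_\sigma)$. For a constant $\bar C_\sigma\ge0$ let $C_\varphi=l_f+\frac{L_gl_f}{\mu}+\bar C_\sigma+\frac{L_f}{\mu}+\frac{2L_g}{\mu}$ and $$\bar C_b=\tfrac{2L_g^2}{\mu}C(L_{0,1},L_g)\Big(\tfrac{L_g^2}{\mu^3}\epsilon_z^2+\tfrac{L_g^4}{\mu^3a_0^2}C_\varphi^2\Big),\qquad \bar C_c=\tfrac{2L_\sigma^2}{\mu}C(L_{0,2},L_\sigma)\Big(\tfrac{L_\sigma^2}{\mu^3}\epsilon_y^2+\tfrac{L_\sigma^4}{\mu^3a_0^2}C_\varphi^2\Big).$$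 Then $0<p_g<1$ and $0<p_\sigma<1$. For every $\bar C_\sigma\ge0$ and every $\epsilon$ with $0<\epsilon\le\min\{1,\bar\sigma\}$ and $\epsilon\rho_f\le\rho_g$, every call of AC-GM terminates, and for every $t\ge1$ $$K_t\le\frac{\log(\bar C_b/\epsilon_z^2)}{\log(1/(1-p_g))},\qquad N_t\le\frac{\log(\bar C_c/\epsilon_y^2)}{\log(1/(1-p_\sigma))}.$$ For $t=0$ the same bounds hold with $\bar C_b$ replaced by $\max\{\bar C_b,\tfrac{2L_g^2}{\mu}C(L_{0,1},L_g)(g(x_0,z_0)-\min_yg(x_0,y))\}$ and $\bar C_c$ replaced by $\max\{\bar C_c,\tfrac{2L_\sigma^2}{\mu}C(L_{0,2},L_\sigma)(g_\epsilon(x_0,y_0)-\min_yg_\epsilon(x_0,y))\}$, where $g_\epsilon=\epsilon f+g$. Consequently each subproblem is solved in $\mathcal O(|\log\epsilon|)$ iterations: there is a constant $C$, independent of $\epsilon$ and $t$, such that for all sufficiently small $\epsilon>0$ and all $t$, $K_t\le C|\log\epsilon|$ and $N_t\le C|\log\epsilon|$. -/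

import Mathlib

open scoped NNReal Topology

noncomputable section

/-- The Euclidean space `ℝᵈ`. -/
abbrev Vec (d : ℕ) : Type := EuclideanSpace ℝ (Fin d)

/-- A function of `(x, y)` seen as a function on `ℝ^{dx} × ℝ^{dy}` with its Euclidean norm. -/
def joint {dx dy : ℕ} (f : Vec dx → Vec dy → ℝ) : WithLp 2 (Vec dx × Vec dy) → ℝ :=
  fun p => f p.fst p.snd

/-- The Polyak-Lojasiewicz condition: `h` attains its minimum `h*` and
`2 μ (h x - h*) ≤ ‖∇ h x‖ ^ 2` for all `x`. -/
def IsPL {d : ℕ} (μ : ℝ) (h : Vec d → ℝ) : Prop :=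
  (∃ xs, ∀ x, h xs ≤ h x) ∧ ∀ x, 2 * μ * (h x - ⨅ z, h z) ≤ ‖gradient h x‖ ^ 2

/-- `F` is differentiable with `L`-Lipschitz gradient. -/
def HasLipschitzGradient {E : Type*} [NormedAddCommGroup E] [InnerProductSpace ℝ E]
    [CompleteSpace E] (L : ℝ≥0) (F : E → ℝ) : Prop :=
  Differentiable ℝ F ∧ LipschitzWith L (gradient F)

/-- `F` is twice differentiable with `ρ`-Lipschitz Hessian (in the operator norm). -/
def HasLipschitzHessian {E : Type*} [NormedAddCommGroup E] [InnerProductSpace ℝ E]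
    [CompleteSpace E] (ρ : ℝ≥0) (F : E → ℝ) : Prop :=
  Differentiable ℝ F ∧ Differentiable ℝ (gradient F) ∧ LipschitzWith ρ (fderiv ℝ (gradient F))

/-- The penalty function `g_σ = σ f + g`. -/
def penalty {dx dy : ℕ} (f g : Vec dx → Vec dy → ℝ) (σ : ℝ) : Vec dx → Vec dy → ℝ :=
  fun x y => σ * f x y + g x y

/-- The standing assumptions on the upper-level function `f` and the lower-level function `g`. -/
structure BilevelAssumption {dx dy : ℕ} (f g : Vec dx → Vec dy → ℝ) (μ σbar : ℝ)
    (lf Lf Lg ρf ρg : ℝ≥0) : Prop where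
  pl : ∀ σ, 0 ≤ σ → σ ≤ σbar → ∀ x, IsPL μ (penalty f g σ x)
  f_lipschitz : LipschitzWith lf (joint f)
  f_gradient : HasLipschitzGradient Lf (joint f)
  g_gradient : HasLipschitzGradient Lg (joint g)
  f_hessian : HasLipschitzHessian ρf (joint f)
  g_hessian : HasLipschitzHessian ρg (joint g)

/-! ### The auto-conditioned gradient method -/

/-- The pair `(x^k, γ_{k+1})`, where `γ_{k+1} = max {L₀, …, L_k}`, of the auto-conditioned
gradient method for minimizing `h`, continued without a stopping test. -/
def acgmIter {d : ℕ} (h : Vec d → ℝ) (x₀ : Vec d) (α L₀ : ℝ) : ℕ → Vec d × ℝ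
  | 0 => (x₀, L₀)
  | k + 1 =>
    let x := (acgmIter h x₀ α L₀ k).1
    let γ := (acgmIter h x₀ α L₀ k).2
    let x' := x - (1 / (α * γ)) • gradient h x
    let L := 2 * (h x' - h x - inner ℝ (gradient h x) (x' - x)) / ‖x' - x‖ ^ 2
    (x', max γ L)

/-- The indices `k` at which the stopping test `‖∇ h (x^k)‖ ≤ ε` succeeds. -/
def acgmStop {d : ℕ} (h : Vec d → ℝ) (x₀ : Vec d) (α L₀ ε : ℝ) : Set ℕ :=
  {k | ‖gradient h (acgmIter h x₀ α L₀ k).1‖ ≤ ε}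

/-- The number of iterations of the `while` loop: the first index at which the stopping test
succeeds. (The junk value `0` is taken if the loop runs forever.) -/
def acgmCount {d : ℕ} (h : Vec d → ℝ) (x₀ : Vec d) (α L₀ ε : ℝ) : ℕ :=
  sInf (acgmStop h x₀ α L₀ ε)

/-- The point returned by the auto-conditioned gradient method. -/
def acgmOut {d : ℕ} (h : Vec d → ℝ) (x₀ : Vec d) (α L₀ ε : ℝ) : Vec d :=
  (acgmIter h x₀ α L₀ (acgmCount h x₀ α L₀ ε)).1

/-! ### The outer algorithm -/

/-- The approximate hypergradient. -/
def approxHypergradient {dx dy : ℕ} (f g : Vec dx → Vec dy → ℝ) (σ : ℝ) (x : Vec dx)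
    (y z : Vec dy) : Vec dx :=
  gradient (fun x' => f x' y) x
    + (1 / σ) • (gradient (fun x' => g x' y) x - gradient (fun x' => g x' z) x)

/-- The input data of the algorithm, apart from the tolerance. -/
structure AlgData (dx dy : ℕ) where
  x₀ : Vec dx
  y₀ : Vec dy
  z₀ : Vec dy
  a₀ : ℝ
  α : ℝ
  L₁ : ℝ
  L₂ : ℝ
  a₀_pos : 0 < a₀
  one_lt_α : 1 < α
  L₁_pos : 0 < L₁
  L₂_pos : 0 < L₂

/-- The state at the beginning of outer iteration `t`: the point `x_t`, the starting points
`z_t^0`, `y_t^0` of the two inner solvers, and `a_t`. -/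
structure OuterState (dx dy : ℕ) where
  x : Vec dx
  z : Vec dy
  y : Vec dy
  a : ℝ

/-- One outer iteration, with inner tolerances `ε ^ 2` and penalty parameter `σ = ε`. -/
def outerStep {dx dy : ℕ} (f g : Vec dx → Vec dy → ℝ) (D : AlgData dx dy) (ε : ℝ)
    (s : OuterState dx dy) : OuterState dx dy :=
  let z := acgmOut (g s.x) s.z D.α D.L₁ (ε ^ 2)
  let y := acgmOut (penalty f g ε s.x) s.y D.α D.L₂ (ε ^ 2)
  let v := approxHypergradient f g ε s.x y z
  let a := √(s.a ^ 2 + ‖v‖ ^ 2)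
  { x := s.x - (1 / a) • v, z := z, y := y, a := a }

/-- The state at the beginning of outer iteration `t`. -/
def outerState {dx dy : ℕ} (f g : Vec dx → Vec dy → ℝ) (D : AlgData dx dy) (ε : ℝ) :
    ℕ → OuterState dx dy
  | 0 => { x := D.x₀, z := D.z₀, y := D.y₀, a := D.a₀ }
  | t + 1 => outerStep f g D ε (outerState f g D ε t)

/-- The indices at which the stopping test of the lower-level subproblem `min_z g(x_t, z)`
succeeds in outer iteration `t`. -/
def lowerStop {dx dy : ℕ} (f g : Vec dx → Vec dy → ℝ) (D : AlgData dx dy) (ε : ℝ) (t : ℕ) :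
    Set ℕ :=
  let s := outerState f g D ε t
  acgmStop (g s.x) s.z D.α D.L₁ (ε ^ 2)

/-- The indices at which the stopping test of the penalty subproblem
`min_y ε f(x_t, y) + g(x_t, y)` succeeds in outer iteration `t`. -/
def penaltyStop {dx dy : ℕ} (f g : Vec dx → Vec dy → ℝ) (D : AlgData dx dy) (ε : ℝ) (t : ℕ) :
    Set ℕ :=
  let s := outerState f g D ε t
  acgmStop (penalty f g ε s.x) s.y D.α D.L₂ (ε ^ 2)

/-- `K_t`, the number of inner iterations for the lower-level subproblem. -/
def lowerCount {dx dy : ℕ} (f g : Vec dx → Vec dy → ℝ) (D : AlgData dx dy) (ε : ℝ) (t : ℕ) : ℕ :=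
  let s := outerState f g D ε t
  acgmCount (g s.x) s.z D.α D.L₁ (ε ^ 2)

/-- `N_t`, the number of inner iterations for the penalty subproblem. -/
def penaltyCount {dx dy : ℕ} (f g : Vec dx → Vec dy → ℝ) (D : AlgData dx dy) (ε : ℝ) (t : ℕ) :
    ℕ :=
  let s := outerState f g D ε t
  acgmCount (penalty f g ε s.x) s.y D.α D.L₂ (ε ^ 2)

/-! ### The constants -/

/-- The linear rate `p = μ (α - 1) / (2 α² max {L₀, L})`. -/
def rateP (μ α L₀ L : ℝ) : ℝ := μ * (α - 1) / (2 * α ^ 2 * max L₀ L)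

/-- The growth constant `max {L³/(μα²L₀²), L²/(μα²L₀), μL/(α²L₀²), μ/(α²L₀)}`. -/
def growthC (μ α L₀ L : ℝ) : ℝ :=
  max (max (L ^ 3 / (μ * α ^ 2 * L₀ ^ 2)) (L ^ 2 / (μ * α ^ 2 * L₀)))
    (max (μ * L / (α ^ 2 * L₀ ^ 2)) (μ / (α ^ 2 * L₀)))

/-- `m = ⌈log_β (max {L₀, L} / L₀)⌉₊` with `β = (α + 1) / 2`. -/
def exceptM (α L₀ L : ℝ) : ℕ := ⌈Real.logb ((α + 1) / 2) (max L₀ L / L₀)⌉₊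

/-- `C = (1 + C̄)^m / (1 - p)^m`. -/
def prefactorC (μ α L₀ L : ℝ) : ℝ :=
  (1 + growthC μ α L₀ L) ^ exceptM α L₀ L / (1 - rateP μ α L₀ L) ^ exceptM α L₀ L

/-- The bound `C_φ` on the approximate hypergradient; `Cs ≥ 0` stands for the
constant in `‖∇φ_σ - ∇φ‖ ≤ Cs σ`. -/
def hypergradC (μ lf Lf Lg Cs : ℝ) : ℝ :=
  (lf + Lg * lf / μ) + Cs + Lf / μ + 2 * (Lg / μ)

/-- `(2L²/μ) C Δ`: the constant that belongs to a bound `Δ` on the initial gap. -/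
def gapConst (μ α L₀ L Δ : ℝ) : ℝ := 2 * L ^ 2 / μ * prefactorC μ α L₀ L * Δ

/-- `C̄ = (2L²/μ) C ((L²/μ³) δ² + L⁴ C_φ² / (μ³ a₀²))`, where `δ` is the inner tolerance. It gives
`C̄_b` for `L = L_g`, `L₀ = L_{0,1}` and `C̄_c` for `L = L_f + L_g`, `L₀ = L_{0,2}`. -/
def warmConst (μ α L₀ L a₀ Cφ δ : ℝ) : ℝ :=
  gapConst μ α L₀ L (L ^ 2 / μ ^ 3 * δ ^ 2 + L ^ 4 / (μ ^ 3 * a₀ ^ 2) * Cφ ^ 2)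

/-- The iteration bound `log (C / δ²) / log (1 / (1 - p))`. -/
def iterBound (C δ p : ℝ) : ℝ := Real.log (C / δ ^ 2) / Real.log (1 / (1 - p))

end

/-! ### Descent estimates for functions with Lipschitz gradient. -/

section Smooth

variable {E : Type*} [NormedAddCommGroup E] [InnerProductSpace ℝ E] [CompleteSpace E]

/-! One run of AC-GM. Call a step good if its curvature estimate is at most `(α + 1) / 2` times the
current `γ`, bad otherwise. By the PL inequality a good step multiplies the gap `h - h*` by at most
`1 - 3p ≤ (1 - p) ^ 2`. A bad step may enlarge the gap, by a factor of at most `1 + growthC`, but it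
also multiplies `γ` by more than `(α + 1) / 2`; since `γ ≤ max L₀ L`, bad steps are few, and
`prefactorC` pays for them. Smoothness gives `‖∇h‖² ≤ 2L (h - h*)`, so a failed stopping test bounds
the iteration index (`acgmIter_gap_le`, `acgm_pow_le`, `acgmCount_le`).

Warm starts. For `t ≥ 1` the initial gap must be bounded uniformly in `t`. The starting point has
gradient at most `ε²` at the previous `x`, and `x` has moved by at most `‖v‖ / a₀`, so PL bounds the
new gap once `‖v‖` is bounded. The danger is the factor `1/σ` in `v`. It is harmless because all
minimizers of `g x` have the same `x`-gradient (`gradient_fst_eq_of_isMin`) and PL puts a minimizer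
within about `‖∇_y g‖ / μ` of any point (`IsPL.exists_isMin_dist_le`): the difference of
`x`-gradients is then `O(ε)`.

Non-constancy of some `g x` yields `μ ≤ Lg`, which keeps the rates below `1` and is used throughout
to compare constants. -/

theorem hasDerivAt_line {F : E → ℝ} (hF : Differentiable ℝ F) (x d : E) (t : ℝ) :
    HasDerivAt (fun s : ℝ => F (x + s • d)) (inner ℝ (gradient F (x + t • d)) d) t := by
  have h1 : HasDerivAt (fun s : ℝ => x + s • d) d t := by
    simpa using ((hasDerivAt_id t).smul_const d).const_add x
  have h2 := (hF (x + t • d)).hasGradientAt.hasFDerivAt.comp_hasDerivAt t h1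
  simpa [Function.comp_def] using h2

/-- The quadratic upper bound for a function with Lipschitz gradient. -/
theorem HasLipschitzGradient.le_quadratic {L : ℝ≥0} {F : E → ℝ} (hF : HasLipschitzGradient L F)
    (x d : E) : F (x + d) ≤ F x + inner ℝ (gradient F x) d + L / 2 * ‖d‖ ^ 2 := by
  let φ : ℝ → ℝ := fun t => F (x + t • d) - t * inner ℝ (gradient F x) d - L / 2 * ‖d‖ ^ 2 * t ^ 2
  have hφ : ∀ t, HasDerivAt φ (inner ℝ (gradient F (x + t • d)) d - inner ℝ (gradient F x) d
      - L / 2 * ‖d‖ ^ 2 * (2 * t)) t := by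
    intro t
    have h2 : HasDerivAt (fun t : ℝ => t * inner ℝ (gradient F x) d)
        (inner ℝ (gradient F x) d) t := by
      simpa using (hasDerivAt_id t).mul_const (inner ℝ (gradient F x) d)
    have h3 : HasDerivAt (fun t : ℝ => L / 2 * ‖d‖ ^ 2 * t ^ 2) (L / 2 * ‖d‖ ^ 2 * (2 * t)) t := by
      simpa using (hasDerivAt_pow 2 t).const_mul (L / 2 * ‖d‖ ^ 2)
    exact ((hasDerivAt_line hF.1 x d t).sub h2).sub h3
  have hanti : AntitoneOn φ (Set.Ici 0) := by
    refine antitoneOn_of_deriv_nonpos (convex_Ici 0)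
      (fun t _ => (hφ t).continuousAt.continuousWithinAt)
      (fun t _ => (hφ t).differentiableAt.differentiableWithinAt) ?_
    intro t ht
    rw [interior_Ici] at ht
    have ht : 0 < t := ht
    rw [(hφ t).deriv, ← inner_sub_left]
    have h1 := real_inner_le_norm (gradient F (x + t • d) - gradient F x) d
    have h2 := hF.2.dist_le_mul (x + t • d) x
    rw [dist_eq_norm, dist_eq_norm, add_sub_cancel_left, norm_smul, Real.norm_of_nonneg ht.le] at h2
    nlinarith [norm_nonneg d, mul_le_mul_of_nonneg_right h2 (norm_nonneg d)]
  have h := hanti (Set.mem_Ici.2 le_rfl) (Set.mem_Ici.2 zero_le_one) zero_le_one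
  simp only [φ, one_smul, zero_smul, add_zero] at h
  linarith

theorem HasLipschitzGradient.mono {L L' : ℝ≥0} {F : E → ℝ} (hF : HasLipschitzGradient L F)
    (h : L ≤ L') : HasLipschitzGradient L' F :=
  ⟨hF.1, hF.2.weaken h⟩

theorem HasLipschitzGradient.gradient_step {L : ℝ≥0} {F : E → ℝ} (hF : HasLipschitzGradient L F)
    (x : E) (s : ℝ) : F (x - s • gradient F x) ≤
      F x - s * ‖gradient F x‖ ^ 2 + L / 2 * s ^ 2 * ‖gradient F x‖ ^ 2 := by
  have h := hF.le_quadratic x (-(s • gradient F x))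
  rw [← sub_eq_add_neg, inner_neg_right, real_inner_smul_right, real_inner_self_eq_norm_sq,
    norm_neg, norm_smul, mul_pow, Real.norm_eq_abs, sq_abs] at h
  linarith

/-- A gradient step of length `1 / L` lowers `F` by at least `‖∇F‖² / (2L)`, yet cannot go below
`c`. -/
theorem HasLipschitzGradient.norm_gradient_sq_le {L : ℝ≥0} (hL : 0 < L) {F : E → ℝ}
    (hF : HasLipschitzGradient L F) {c : ℝ} (hc : ∀ x, c ≤ F x) (x : E) :
    ‖gradient F x‖ ^ 2 ≤ 2 * L * (F x - c) := by
  have hL' : (0 : ℝ) < L := hL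
  have h := hF.gradient_step x (1 / L)
  have h1 := hc (x - (1 / L : ℝ) • gradient F x)
  have h2 : (L : ℝ) / 2 * (1 / L) ^ 2 = 1 / (2 * L) := by field_simp
  rw [h2] at h
  have h3 : (1 / L - 1 / (2 * L)) * ‖gradient F x‖ ^ 2 ≤ F x - c := by linarith
  have h4 : (1 / L - 1 / (2 * L) : ℝ) = 1 / (2 * L) := by field_simp; norm_num
  rw [h4, one_div, inv_mul_le_iff₀ (by positivity)] at h3
  exact h3

end Smooth

/-! ### Consequences of the Polyak-Lojasiewicz inequality. -/

section PL

variable {d : ℕ} {μ : ℝ} {h : Vec d → ℝ}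

theorem IsPL.ciInf_le (hh : IsPL μ h) (x : Vec d) : ⨅ z, h z ≤ h x := by
  obtain ⟨xs, hxs⟩ := hh.1
  exact _root_.ciInf_le ⟨h xs, by rintro _ ⟨y, rfl⟩; exact hxs y⟩ x

theorem IsPL.gap_le (hμ : 0 < μ) (hh : IsPL μ h) (x : Vec d) :
    h x - ⨅ z, h z ≤ ‖gradient h x‖ ^ 2 / (2 * μ) := by
  rw [le_div_iff₀ (by positivity)]
  linarith [hh.2 x]

/-- At a point with positive gap `Δ`, PL and smoothness give `2μΔ ≤ ‖∇h‖² ≤ 2LΔ`. -/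
theorem IsPL.le_of_not_const (hh : IsPL μ h) {L : ℝ≥0} (hL : HasLipschitzGradient L h)
    (hne : ∃ y y', h y ≠ h y') : μ ≤ L := by
  obtain ⟨y, hy⟩ : ∃ y, ⨅ z, h z < h y := by
    by_contra! hcon
    obtain ⟨y, y', hyy⟩ := hne
    exact hyy (le_antisymm ((hcon y).trans (hh.ciInf_le y')) ((hcon y').trans (hh.ciInf_le y)))
  by_contra! hlt
  -- `L` may be `0`, while `norm_gradient_sq_le` needs a positive constant.
  obtain ⟨M, hLM, hMμ⟩ : ∃ M : ℝ≥0, L < M ∧ (M : ℝ) < μ := by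
    obtain ⟨m, hm1, hm2⟩ := exists_between hlt
    exact ⟨⟨m, L.2.trans hm1.le⟩, hm1, hm2⟩
  have hM : 0 < M := pos_of_gt hLM
  have h1 := (hL.mono hLM.le).norm_gradient_sq_le hM hh.ciInf_le y
  nlinarith [hh.2 y]

/-- A quantitative error bound: a PL function has a minimizer within distance
`‖∇ h u‖ / (θ μ)` of `u`, for every `θ < 1`. -/
theorem IsPL.exists_isMin_dist_le (hμ : 0 < μ) (hh : IsPL μ h) {L : ℝ≥0}
    (hL : HasLipschitzGradient L h) {θ : ℝ} (hθ0 : 0 < θ) (hθ1 : θ < 1) (u : Vec d) :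
    ∃ v, h v = ⨅ z, h z ∧ θ * μ * ‖v - u‖ ≤ ‖gradient h u‖ := by
  set m := ⨅ z, h z with hm
  have hgap : ∀ x, 0 ≤ h x - m := fun x => sub_nonneg.2 (hh.ciInf_le x)
  set c := θ * √(μ / 2) with hc
  have hμ2 : 0 < √(μ / 2) := Real.sqrt_pos.2 (by positivity)
  have hc0 : 0 < c := mul_pos hθ0 hμ2
  have hc2 : c ^ 2 = θ ^ 2 * (μ / 2) := by rw [hc, mul_pow, Real.sq_sqrt (by positivity)]
  -- Ekeland's idea in a proper space: the penalized function is coercive and attains its minimum.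
  -- Where `h > m`, PL says that `√(h - m)` has slope at least `√(μ / 2) > c`, so a minimizer `v`
  -- must satisfy `h v = m`.
  obtain ⟨v, hv⟩ : ∃ v, ∀ w, √(h v - m) + c * ‖v - u‖ ≤ √(h w - m) + c * ‖w - u‖ := by
    refine Continuous.exists_forall_le (f := fun w => √(h w - m) + c * ‖w - u‖)
      (((hL.1.continuous.sub continuous_const).sqrt).add
        (continuous_const.mul (continuous_id.sub continuous_const).norm)) ?_
    have h1 : Filter.Tendsto (fun w : Vec d => c * (‖w‖ - ‖u‖)) (Filter.cocompact (Vec d))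
        Filter.atTop :=
      Filter.Tendsto.const_mul_atTop hc0
        (Filter.tendsto_atTop_add_const_right _ _ (tendsto_norm_cocompact_atTop (E := Vec d)))
    refine Filter.tendsto_atTop_mono (fun w => ?_) h1
    have := norm_sub_norm_le w u
    nlinarith [Real.sqrt_nonneg (h w - m)]
  have hvm : h v = m := by
    by_contra hne
    have hpos : 0 < h v - m := lt_of_le_of_ne (hgap v) (fun e => hne (by linarith))
    set G := ‖gradient h v‖ with hG
    have hPL : 2 * μ * (h v - m) ≤ G ^ 2 := hh.2 v
    have hG0 : 0 < G := by
      rcases (norm_nonneg (gradient h v)).eq_or_lt with h0 | h0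
      · rw [hG, ← h0] at hPL; nlinarith
      · exact h0
    set D := √(h v - m) with hD
    have hD0 : 0 < D := Real.sqrt_pos.2 hpos
    have hDsq : D ^ 2 = h v - m := Real.sq_sqrt hpos.le
    have hcD : 2 * c * D ≤ θ * G := by
      refine abs_le_of_sq_le_sq' ?_ (by positivity) |>.2
      have : (2 * c * D) ^ 2 = θ ^ 2 * (2 * μ * (h v - m)) := by
        rw [mul_pow, mul_pow, hc2, hDsq]; ring
      rw [this, mul_pow]
      gcongr
    -- Compare `v` with a gradient step of length `s`. The conclusion fails for small `s`, and this
    -- is the contradiction.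
    have key : ∀ s : ℝ, 0 < s → c * s * G ≤ D → 1 - θ ≤ L / 2 * s := by
      intro s hs hsD
      have h1 := hL.gradient_step v s
      have h2 := hv (v - s • gradient h v)
      have h3 : ‖v - s • gradient h v - u‖ ≤ ‖v - u‖ + s * G := by
        have h4 : v - s • gradient h v - u = (v - u) - s • gradient h v := by abel
        rw [h4]
        refine (norm_sub_le _ _).trans ?_
        rw [norm_smul, Real.norm_of_nonneg hs.le]
      have h5 : D - c * s * G ≤ √(h (v - s • gradient h v) - m) := by
        have := mul_le_mul_of_nonneg_left h3 hc0.le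
        nlinarith
      have h6 : (D - c * s * G) ^ 2 ≤ h (v - s • gradient h v) - m := by
        rw [← Real.sq_sqrt (hgap (v - s • gradient h v))]
        exact pow_le_pow_left₀ (by linarith) h5 2
      have h7 : s * G * ((1 - L / 2 * s) * G) ≤ s * G * (θ * G) := by
        have := mul_le_mul_of_nonneg_left hcD (mul_pos hs hG0).le
        nlinarith [sq_nonneg (c * s * G)]
      have h8 := le_of_mul_le_mul_left h7 (mul_pos hs hG0)
      have h9 := le_of_mul_le_mul_right h8 hG0
      linarith
    set s := min (D / (c * G)) ((1 - θ) / (L + 1)) with hs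
    have hs0 : 0 < s := lt_min (by positivity) (div_pos (by linarith) (by positivity))
    have h1 := key s hs0 (by
      have := min_le_left (D / (c * G)) ((1 - θ) / (L + 1))
      rw [← hs, le_div_iff₀ (by positivity)] at this
      linarith)
    have h2 := min_le_right (D / (c * G)) ((1 - θ) / (L + 1))
    rw [← hs, le_div_iff₀ (by positivity)] at h2
    have h3 : 0 ≤ L * s := by positivity
    linarith
  refine ⟨v, hvm, ?_⟩
  have h1 := hv u
  rw [hvm] at h1
  simp only [sub_self, Real.sqrt_zero, norm_zero, mul_zero, add_zero, zero_add] at h1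
  have h2 : (c * ‖v - u‖) ^ 2 ≤ h u - m := by
    rw [← Real.sq_sqrt (hgap u)]
    exact pow_le_pow_left₀ (by positivity) h1 2
  have h3 : 2 * μ * (h u - m) ≤ ‖gradient h u‖ ^ 2 := hh.2 u
  refine abs_le_of_sq_le_sq' ?_ (norm_nonneg _) |>.2
  rw [mul_pow, hc2] at h2
  nlinarith [mul_le_mul_of_nonneg_left h2 hμ.le]

end PL

/-! ### Elementary bounds on the constants. -/

section Constants

variable {μ α L₀ L : ℝ}

theorem rateP_pos (hμ : 0 < μ) (hα : 1 < α) (hL₀ : 0 < L₀) : 0 < rateP μ α L₀ L := by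
  have : 0 < max L₀ L := lt_max_of_lt_left hL₀
  have : 0 < α - 1 := by linarith
  unfold rateP
  positivity

/-- Combines `μ ≤ max L₀ L` with `(α - 1) / α² ≤ 1 / 4`, that is `(α - 2)² ≥ 0`. -/
theorem rateP_le (hμ : 0 < μ) (hα : 1 < α) (hμL : μ ≤ L) : rateP μ α L₀ L ≤ 1 / 8 := by
  have hM : μ ≤ max L₀ L := hμL.trans (le_max_right _ _)
  have hM0 : 0 < max L₀ L := hμ.trans_le hM
  unfold rateP
  rw [div_le_div_iff₀ (by positivity) (by norm_num)]
  have h1 : μ * (α - 1) ≤ max L₀ L * (α - 1) := mul_le_mul_of_nonneg_right hM (by linarith)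
  nlinarith [mul_nonneg hM0.le (sq_nonneg (α - 2))]

theorem growthC_nonneg (hμ : 0 < μ) (hα : 1 < α) (hL₀ : 0 < L₀) : 0 ≤ growthC μ α L₀ L := by
  unfold growthC
  exact le_max_of_le_right (le_max_of_le_right (by positivity))

theorem le_growthC (hμ : 0 < μ) (hα : 1 < α) (hL₀ : 0 < L₀) (hμL : μ ≤ L) :
    L ^ 2 / (α ^ 2 * L₀ ^ 2) ≤ growthC μ α L₀ L := by
  unfold growthC
  refine le_max_of_le_left (le_max_of_le_left ?_)
  rw [div_le_div_iff₀ (by positivity) (by positivity)]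
  have h1 := mul_le_mul_of_nonneg_right hμL
    (show 0 ≤ L ^ 2 * (α ^ 2 * L₀ ^ 2) by positivity)
  nlinarith

theorem one_le_prefactorC (hμ : 0 < μ) (hα : 1 < α) (hL₀ : 0 < L₀) (hμL : μ ≤ L) :
    1 ≤ prefactorC μ α L₀ L := by
  have h1 := rateP_pos (L := L) hμ hα hL₀
  have h2 := rateP_le (L₀ := L₀) hμ hα hμL
  have h3 := growthC_nonneg (L := L) hμ hα hL₀
  unfold prefactorC
  rw [one_le_div (pow_pos (by linarith) _)]
  exact pow_le_pow_left₀ (by linarith) (by linarith) _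

theorem gapConst_mono (hμ : 0 < μ) (hα : 1 < α) (hL₀ : 0 < L₀) (hμL : μ ≤ L) :
    Monotone (gapConst μ α L₀ L) := by
  intro a b hab
  have := one_le_prefactorC hμ hα hL₀ hμL
  unfold gapConst
  gcongr

end Constants

/-! ### Convergence of AC-GM under PL. -/

section ACGM

variable {d : ℕ} {μ α L₀ : ℝ} {L : ℝ≥0} {h : Vec d → ℝ}

theorem acgmIter_estimate_le (hL : HasLipschitzGradient L h) (x x' : Vec d) :
    2 * (h x' - h x - inner ℝ (gradient h x) (x' - x)) / ‖x' - x‖ ^ 2 ≤ L := by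
  rcases eq_or_ne x' x with rfl | hne
  · simp
  · have h0 : 0 < ‖x' - x‖ := norm_pos_iff.2 (sub_ne_zero.2 hne)
    rw [div_le_iff₀ (by positivity)]
    have h1 := hL.le_quadratic x (x' - x)
    rw [add_sub_cancel] at h1
    linarith

/-- The value after a gradient step, in terms of the local curvature estimate along the step. -/
theorem acgm_value_eq (x : Vec d) (s : ℝ) :
    h (x - s • gradient h x) = h x - s * ‖gradient h x‖ ^ 2 +
      2 * (h (x - s • gradient h x) - h x
        - inner ℝ (gradient h x) (x - s • gradient h x - x)) /
        ‖x - s • gradient h x - x‖ ^ 2 / 2 * s ^ 2 * ‖gradient h x‖ ^ 2 := by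
  rcases eq_or_ne (s • gradient h x) 0 with h0 | h0
  -- A zero step makes the estimate `0 / 0 = 0`; the identity survives because both correction terms
  -- vanish.
  · have h2 : s * ‖gradient h x‖ ^ 2 = 0 := by
      rcases smul_eq_zero.1 h0 with h1 | h1 <;> simp [h1]
    have h3 : s ^ 2 * ‖gradient h x‖ ^ 2 = 0 := by rw [sq, mul_assoc, h2, mul_zero]
    rw [mul_assoc _ (s ^ 2), h3, h2, h0]
    simp
  · have h1 : x - s • gradient h x - x = -(s • gradient h x) := by abel
    have hs : s ≠ 0 := fun e => h0 (by simp [e])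
    have hg : ‖gradient h x‖ ≠ 0 := fun e => h0 (by simp [norm_eq_zero.1 e])
    rw [h1, inner_neg_right, real_inner_smul_right, real_inner_self_eq_norm_sq,
      norm_neg, norm_smul, mul_pow, Real.norm_eq_abs, sq_abs]
    field_simp
    ring

theorem acgm_step_good (hμ : 0 < μ) (hα : 1 < α) (hh : IsPL μ h) {γ M ℓ : ℝ} (hγ : 0 < γ)
    (hγM : γ ≤ M) {x x' : Vec d} (hℓ : ℓ ≤ (α + 1) / 2 * γ)
    (hx' : h x' = h x - 1 / (α * γ) * ‖gradient h x‖ ^ 2 +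
      ℓ / 2 * (1 / (α * γ)) ^ 2 * ‖gradient h x‖ ^ 2) :
    h x' - ⨅ z, h z ≤ (1 - 3 * (μ * (α - 1) / (2 * α ^ 2 * M))) * (h x - ⨅ z, h z) := by
  have hM : 0 < M := hγ.trans_le hγM
  have hα0 : 0 < α := by linarith
  set Δ := h x - ⨅ z, h z with hΔ
  have hΔ0 : 0 ≤ Δ := sub_nonneg.2 (hh.ciInf_le x)
  have hPL : 2 * μ * Δ ≤ ‖gradient h x‖ ^ 2 := hh.2 x
  set G := ‖gradient h x‖ ^ 2 with hG
  have hG0 : 0 ≤ G := by positivity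
  have h1 : h x' - ⨅ z, h z ≤ Δ - (3 * α - 1) / (4 * α ^ 2 * γ) * G := by
    have h2 : ℓ / 2 * (1 / (α * γ)) ^ 2 * G ≤ (α + 1) / 2 * γ / 2 * (1 / (α * γ)) ^ 2 * G := by
      gcongr
    have h3 : (3 * α - 1) / (4 * α ^ 2 * γ) * G =
        1 / (α * γ) * G - (α + 1) / 2 * γ / 2 * (1 / (α * γ)) ^ 2 * G := by
      field_simp; ring
    rw [h3, hx', hΔ]
    linarith
  have h4 : 3 * (μ * (α - 1) / (2 * α ^ 2 * M)) * Δ ≤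
      (3 * α - 1) / (4 * α ^ 2 * γ) * (2 * μ * Δ) := by
    have h5 : 3 * (μ * (α - 1) / (2 * α ^ 2 * M)) ≤ 3 * (μ * (α - 1) / (2 * α ^ 2 * γ)) := by
      have : 0 < α - 1 := by linarith
      gcongr
    have h6 : 3 * (μ * (α - 1) / (2 * α ^ 2 * γ)) ≤ (3 * α - 1) / (4 * α ^ 2 * γ) * (2 * μ) := by
      have h7 : (3 * α - 1) / (4 * α ^ 2 * γ) * (2 * μ) - 3 * (μ * (α - 1) / (2 * α ^ 2 * γ))
          = μ / (α ^ 2 * γ) := by field_simp; ring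
      have : 0 < μ / (α ^ 2 * γ) := by positivity
      linarith
    rw [← mul_assoc _ (2 * μ) Δ]
    exact mul_le_mul_of_nonneg_right (h5.trans h6) hΔ0
  have h8 : (3 * α - 1) / (4 * α ^ 2 * γ) * (2 * μ * Δ) ≤ (3 * α - 1) / (4 * α ^ 2 * γ) * G :=
    mul_le_mul_of_nonneg_left hPL (div_nonneg (by linarith) (by positivity))
  linarith

/-- The step length is at most `1 / (α L₀)` and `‖∇h‖² ≤ 2LΔ`, so the curvature term adds at most
`L² / (α² L₀²) · Δ`. -/
theorem acgm_step_any (hμ : 0 < μ) (hα : 1 < α) (hL₀ : 0 < L₀) (hh : IsPL μ h)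
    (hL : HasLipschitzGradient L h) (hμL : μ ≤ L) {γ ℓ : ℝ} (hγ : L₀ ≤ γ)
    {x x' : Vec d} (hℓ : ℓ ≤ L)
    (hx' : h x' = h x - 1 / (α * γ) * ‖gradient h x‖ ^ 2 +
      ℓ / 2 * (1 / (α * γ)) ^ 2 * ‖gradient h x‖ ^ 2) :
    h x' - ⨅ z, h z ≤ (1 + growthC μ α L₀ L) * (h x - ⨅ z, h z) := by
  have hγ0 : 0 < γ := hL₀.trans_le hγ
  have hα0 : 0 < α := by linarith
  have hL0 : (0 : ℝ) < L := hμ.trans_le hμL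
  have hG := hL.norm_gradient_sq_le hL0 hh.ciInf_le x
  set Δ := h x - ⨅ z, h z with hΔ
  have hΔ0 : 0 ≤ Δ := sub_nonneg.2 (hh.ciInf_le x)
  have h1 : ℓ / 2 * (1 / (α * γ)) ^ 2 * ‖gradient h x‖ ^ 2 ≤
      L / 2 * (1 / (α * L₀)) ^ 2 * (2 * L * Δ) := by
    gcongr
  have h2 : L / 2 * (1 / (α * L₀)) ^ 2 * (2 * L * Δ) = L ^ 2 / (α ^ 2 * L₀ ^ 2) * Δ := by
    field_simp
  have h3 := mul_le_mul_of_nonneg_right (le_growthC hμ hα hL₀ hμL) hΔ0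
  have h4 : 0 ≤ 1 / (α * γ) * ‖gradient h x‖ ^ 2 := by positivity
  linarith

/-- After `b + c` iterations, of which `b` increased the step parameter by the factor
`(α + 1) / 2` at least. -/
theorem acgmIter_gap_le (hμ : 0 < μ) (hα : 1 < α) (hL₀ : 0 < L₀) (hh : IsPL μ h)
    (hL : HasLipschitzGradient L h) (hμL : μ ≤ L) (x₀ : Vec d) (k : ℕ) :
    (L₀ ≤ (acgmIter h x₀ α L₀ k).2 ∧ (acgmIter h x₀ α L₀ k).2 ≤ max L₀ L) ∧
    ∃ b c : ℕ, b + c = k ∧ L₀ * ((α + 1) / 2) ^ b ≤ (acgmIter h x₀ α L₀ k).2 ∧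
      (1 ≤ b → L₀ * ((α + 1) / 2) ^ b < (acgmIter h x₀ α L₀ k).2) ∧
      h (acgmIter h x₀ α L₀ k).1 - ⨅ z, h z ≤
        (1 + growthC μ α L₀ L) ^ b * (1 - rateP μ α L₀ L) ^ (2 * c) * (h x₀ - ⨅ z, h z) := by
  induction k with
  -- Initially `γ = L₀`, so strictness fails for `b = 0`; hence the guard `1 ≤ b`.
  | zero => exact ⟨⟨le_rfl, le_max_left _ _⟩, 0, 0, rfl, by simp [acgmIter], by simp,
      by simp [acgmIter]⟩
  | succ k ih =>
    have hp := rateP_pos (L := L) hμ hα hL₀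
    have hp8 := rateP_le (L₀ := L₀) hμ hα hμL
    have hC := growthC_nonneg (L := L) hμ hα hL₀
    obtain ⟨⟨hγ0, hγM⟩, b, c, hbc, hγb, hγb', hgap⟩ := ih
    rw [acgmIter]
    dsimp only
    set x := (acgmIter h x₀ α L₀ k).1
    set γ := (acgmIter h x₀ α L₀ k).2
    have hγp : 0 < γ := hL₀.trans_le hγ0
    have hval := acgm_value_eq (h := h) x (1 / (α * γ))
    have hℓL := acgmIter_estimate_le hL x (x - (1 / (α * γ)) • gradient h x)
    set x' := x - (1 / (α * γ)) • gradient h x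
    set ℓ := 2 * (h x' - h x - inner ℝ (gradient h x) (x' - x)) / ‖x' - x‖ ^ 2
    refine ⟨⟨hγ0.trans (le_max_left _ _), max_le hγM (hℓL.trans (le_max_right _ _))⟩, ?_⟩
    rcases le_or_gt ℓ ((α + 1) / 2 * γ) with hgood | hbad
    · refine ⟨b, c + 1, by omega, hγb.trans (le_max_left _ _),
        fun hb => (hγb' hb).trans_le (le_max_left _ _), ?_⟩
      have h1 := acgm_step_good hμ hα hh hγp hγM hgood hval
      have h2 : (1 - 3 * rateP μ α L₀ L) ≤ (1 - rateP μ α L₀ L) ^ 2 := by nlinarith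
      calc _ ≤ _ := h1
        _ ≤ (1 - rateP μ α L₀ L) ^ 2 * (h x - ⨅ z, h z) :=
          mul_le_mul_of_nonneg_right h2 (sub_nonneg.2 (hh.ciInf_le x))
        _ ≤ (1 - rateP μ α L₀ L) ^ 2 * _ := mul_le_mul_of_nonneg_left hgap (by positivity)
        _ = _ := by ring
    · have h0 : L₀ * ((α + 1) / 2) ^ (b + 1) < max γ ℓ := by
        refine lt_max_of_lt_right (lt_of_le_of_lt ?_ hbad)
        calc _ = (α + 1) / 2 * (L₀ * ((α + 1) / 2) ^ b) := by ring
          _ ≤ _ := mul_le_mul_of_nonneg_left hγb (by linarith)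
      refine ⟨b + 1, c, by omega, h0.le, fun _ => h0, ?_⟩
      have h1 := acgm_step_any hμ hα hL₀ hh hL hμL hγ0 hℓL hval
      calc _ ≤ _ := h1
        _ ≤ (1 + growthC μ α L₀ L) * _ := mul_le_mul_of_nonneg_left hgap (by linarith)
        _ = _ := by ring

theorem lt_exceptM (hα : 1 < α) (hL₀ : 0 < L₀) {M : ℝ} {b : ℕ}
    (hb : L₀ * ((α + 1) / 2) ^ b < max L₀ M) : b < exceptM α L₀ M := by
  have hM : 0 < max L₀ M := lt_max_of_lt_left hL₀
  unfold exceptM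
  rw [Nat.lt_ceil, Real.lt_logb_iff_rpow_lt (by linarith) (by positivity), Real.rpow_natCast,
    lt_div_iff₀ hL₀]
  linarith

/-- If the stopping test fails at `k`, then `k` is at least one below the iteration bound. -/
theorem acgm_pow_le (hμ : 0 < μ) (hα : 1 < α) (hL₀ : 0 < L₀) (hh : IsPL μ h)
    (hL : HasLipschitzGradient L h) (hμL : μ ≤ L) (x₀ : Vec d) {δ A : ℝ} (hδ : 0 < δ)
    (hA : 2 * δ ^ 2 ≤ A) (hgapA : gapConst μ α L₀ L (h x₀ - ⨅ z, h z) ≤ A) (k : ℕ)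
    (hk : δ < ‖gradient h (acgmIter h x₀ α L₀ k).1‖) :
    (1 / (1 - rateP μ α L₀ L)) ^ (k + 1) ≤ A / δ ^ 2 := by
  have hL0 : (0 : ℝ) < L := hμ.trans_le hμL
  have hp := rateP_pos (L := L) hμ hα hL₀
  have hp8 := rateP_le (L₀ := L₀) hμ hα hμL
  have hC := growthC_nonneg (L := L) hμ hα hL₀
  obtain ⟨⟨-, hγM⟩, b, c, hbc, hγb, hγb', hgap⟩ := acgmIter_gap_le hμ hα hL₀ hh hL hμL x₀ k
  have hG := hL.norm_gradient_sq_le hL0 hh.ciInf_le (acgmIter h x₀ α L₀ k).1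
  set q := 1 - rateP μ α L₀ L with hq
  have hq0 : 0 < q := by linarith
  have hq1 : q ≤ 1 := by linarith
  have hΔ0 : 0 ≤ h x₀ - ⨅ z, h z := sub_nonneg.2 (hh.ciInf_le x₀)
  set Δ := h x₀ - ⨅ z, h z
  rw [div_pow, one_pow, div_le_div_iff₀ (by positivity) (by positivity), one_mul]
  -- The exponent `k + 1` leaves no room when `k = 0`; there `2 * δ ^ 2 ≤ A` and `p ≤ 1 / 8`
  -- suffice.
  by_cases hk0 : b = 0 ∧ k = 0
  · rw [hk0.2, zero_add, pow_one]
    have h1 : A * (7 / 8) ≤ A * q := mul_le_mul_of_nonneg_left (by linarith) (by nlinarith)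
    nlinarith
  have hfac : (1 + growthC μ α L₀ L) ^ b * q ^ (2 * c) ≤ prefactorC μ α L₀ L * q ^ (k + 1) := by
    rcases Nat.eq_zero_or_pos b with hb | hb
    -- Here `c = k ≥ 1`, so the two powers gained per good step cover `k + 1`.
    · have h1 : q ^ (2 * c) ≤ q ^ (k + 1) := pow_le_pow_of_le_one hq0.le hq1 (by omega)
      have h2 := one_le_prefactorC hμ hα hL₀ hμL
      rw [hb, pow_zero, one_mul]
      have := pow_pos hq0 (k + 1)
      nlinarith
    -- The strict growth of `γ` gives `b < m`, hence `2c + m ≥ k + 1`: the denominator of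
    -- `prefactorC` supplies the `m` missing powers of `q`.
    · have hbm : b + 1 ≤ exceptM α L₀ L := lt_exceptM hα hL₀ ((hγb' hb).trans_le hγM)
      set m := exceptM α L₀ L
      have h1 : (1 + growthC μ α L₀ L) ^ b ≤ (1 + growthC μ α L₀ L) ^ m :=
        pow_le_pow_right₀ (by linarith) (by omega)
      have h2 : q ^ (2 * c) * q ^ m ≤ q ^ (k + 1) := by
        rw [← pow_add]
        exact pow_le_pow_of_le_one hq0.le hq1 (by omega)
      rw [prefactorC, div_mul_eq_mul_div, le_div_iff₀ (by positivity), mul_assoc]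
      exact mul_le_mul h1 h2 (by positivity) (by positivity)
  have h1 : δ ^ 2 < ‖gradient h (acgmIter h x₀ α L₀ k).1‖ ^ 2 :=
    pow_lt_pow_left₀ hk hδ.le (by norm_num)
  calc δ ^ 2 ≤ 2 * L * ((1 + growthC μ α L₀ L) ^ b * q ^ (2 * c) * Δ) :=
        h1.le.trans (hG.trans (mul_le_mul_of_nonneg_left hgap (by positivity)))
    _ ≤ 2 * L * (prefactorC μ α L₀ L * q ^ (k + 1) * Δ) := by gcongr
    _ ≤ 2 * L ^ 2 / μ * (prefactorC μ α L₀ L * q ^ (k + 1) * Δ) := by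
        have h2 := one_le_prefactorC hμ hα hL₀ hμL
        refine mul_le_mul_of_nonneg_right ?_ (by positivity)
        rw [le_div_iff₀ hμ]
        nlinarith
    _ = gapConst μ α L₀ L Δ * q ^ (k + 1) := by unfold gapConst; ring
    _ ≤ A * q ^ (k + 1) := by gcongr

theorem acgmCount_isLeast (hμ : 0 < μ) (hα : 1 < α) (hL₀ : 0 < L₀) (hh : IsPL μ h)
    (hL : HasLipschitzGradient L h) (hμL : μ ≤ L) (x₀ : Vec d) {δ : ℝ} (hδ : 0 < δ) :
    IsLeast (acgmStop h x₀ α L₀ δ) (acgmCount h x₀ α L₀ δ) := by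
  have hp := rateP_pos (L := L) hμ hα hL₀
  have hp8 := rateP_le (L₀ := L₀) hμ hα hμL
  have hne : (acgmStop h x₀ α L₀ δ).Nonempty := by
    by_contra hcon
    rw [Set.not_nonempty_iff_eq_empty, Set.eq_empty_iff_forall_notMem] at hcon
    set A := max (2 * δ ^ 2) (gapConst μ α L₀ L (h x₀ - ⨅ z, h z))
    obtain ⟨n, hn⟩ := pow_unbounded_of_one_lt (A / δ ^ 2)
      (show 1 < 1 / (1 - rateP μ α L₀ L) by rw [lt_div_iff₀] <;> linarith)
    have h1 := acgm_pow_le hμ hα hL₀ hh hL hμL x₀ hδ (le_max_left _ _) (le_max_right _ _) n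
      (not_le.1 (hcon n))
    have h2 : (1 / (1 - rateP μ α L₀ L)) ^ n ≤ (1 / (1 - rateP μ α L₀ L)) ^ (n + 1) :=
      pow_le_pow_right₀ (by rw [le_div_iff₀] <;> linarith) (Nat.le_succ n)
    linarith
  exact ⟨Nat.sInf_mem hne, fun k hk => Nat.sInf_le hk⟩

theorem norm_gradient_acgmOut_le (hμ : 0 < μ) (hα : 1 < α) (hL₀ : 0 < L₀) (hh : IsPL μ h)
    (hL : HasLipschitzGradient L h) (hμL : μ ≤ L) (x₀ : Vec d) {δ : ℝ} (hδ : 0 < δ) :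
    ‖gradient h (acgmOut h x₀ α L₀ δ)‖ ≤ δ :=
  (acgmCount_isLeast hμ hα hL₀ hh hL hμL x₀ hδ).1

theorem acgmCount_le (hμ : 0 < μ) (hα : 1 < α) (hL₀ : 0 < L₀) (hh : IsPL μ h)
    (hL : HasLipschitzGradient L h) (hμL : μ ≤ L) (x₀ : Vec d) {δ A : ℝ} (hδ : 0 < δ)
    (hA : 2 * δ ^ 2 ≤ A) (hgapA : gapConst μ α L₀ L (h x₀ - ⨅ z, h z) ≤ A) :
    (acgmCount h x₀ α L₀ δ : ℝ) ≤ iterBound A δ (rateP μ α L₀ L) := by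
  have hp := rateP_pos (L := L) hμ hα hL₀
  have hp8 := rateP_le (L₀ := L₀) hμ hα hμL
  have hr : 1 < 1 / (1 - rateP μ α L₀ L) := by rw [lt_div_iff₀] <;> linarith
  have hA0 : 0 < A := lt_of_lt_of_le (by positivity) hA
  unfold iterBound
  rw [le_div_iff₀ (Real.log_pos hr), ← Real.log_pow]
  refine Real.log_le_log (by positivity) ?_
  rcases Nat.eq_zero_or_pos (acgmCount h x₀ α L₀ δ) with h0 | h0
  · rw [h0, pow_zero, le_div_iff₀ (by positivity)]
    nlinarith
  -- The test fails at `k`, the last index before the stop, so the exponent `k + 1` is the count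
  -- itself.
  · obtain ⟨k, hk⟩ := Nat.exists_eq_succ_of_ne_zero h0.ne'
    rw [hk]
    refine acgm_pow_le hμ hα hL₀ hh hL hμL x₀ hδ hA hgapA k (not_le.1 fun hle => ?_)
    have := (acgmCount_isLeast hμ hα hL₀ hh hL hμL x₀ hδ).2 hle
    omega

end ACGM

/-! ### Partial gradients and their dependence on the lower-level point. -/

section Partial

variable {dx dy : ℕ} {f g : Vec dx → Vec dy → ℝ}

theorem hasGradientAt_snd (hg : Differentiable ℝ (joint g)) (x : Vec dx) (y : Vec dy) :
    HasGradientAt (g x) (gradient (joint g) (WithLp.toLp 2 (x, y))).snd y := by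
  rw [hasGradientAt_iff_hasFDerivAt]
  have h1 := (hg (WithLp.toLp 2 (x, y))).hasGradientAt.hasFDerivAt
  have h2 : HasFDerivAt (fun y' : Vec dy => WithLp.toLp 2 (x, y'))
      (((WithLp.prodContinuousLinearEquiv 2 ℝ (Vec dx) (Vec dy)).symm :
        Vec dx × Vec dy →L[ℝ] WithLp 2 (Vec dx × Vec dy)).comp
          (ContinuousLinearMap.inr ℝ (Vec dx) (Vec dy))) y :=
    ((WithLp.prodContinuousLinearEquiv 2 ℝ (Vec dx) (Vec dy)).symm.hasFDerivAt).comp y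
      (hasFDerivAt_prodMk_right x y)
  refine (h1.comp y h2).congr_fderiv ?_
  ext v
  generalize gradient (joint g) _ = G
  simp [WithLp.prod_inner_apply]

theorem hasGradientAt_fst (hg : Differentiable ℝ (joint g)) (x : Vec dx) (y : Vec dy) :
    HasGradientAt (fun x' => g x' y) (gradient (joint g) (WithLp.toLp 2 (x, y))).fst x := by
  rw [hasGradientAt_iff_hasFDerivAt]
  have h1 := (hg (WithLp.toLp 2 (x, y))).hasGradientAt.hasFDerivAt
  have h2 : HasFDerivAt (fun x' : Vec dx => WithLp.toLp 2 (x', y))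
      (((WithLp.prodContinuousLinearEquiv 2 ℝ (Vec dx) (Vec dy)).symm :
        Vec dx × Vec dy →L[ℝ] WithLp 2 (Vec dx × Vec dy)).comp
          (ContinuousLinearMap.inl ℝ (Vec dx) (Vec dy))) x :=
    ((WithLp.prodContinuousLinearEquiv 2 ℝ (Vec dx) (Vec dy)).symm.hasFDerivAt).comp x
      (hasFDerivAt_prodMk_left x y)
  refine (h1.comp x h2).congr_fderiv ?_
  ext v
  generalize gradient (joint g) _ = G
  simp [WithLp.prod_inner_apply]

theorem norm_toLp_sub_left (x x' : Vec dx) (y : Vec dy) :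
    ‖(WithLp.toLp 2 (x, y) - WithLp.toLp 2 (x', y) : WithLp 2 (Vec dx × Vec dy))‖ = ‖x - x'‖ := by
  rw [← sq_eq_sq₀ (norm_nonneg _) (norm_nonneg _), WithLp.prod_norm_sq_eq_of_L2]
  simp

theorem norm_toLp_sub_right (x : Vec dx) (y y' : Vec dy) :
    ‖(WithLp.toLp 2 (x, y) - WithLp.toLp 2 (x, y') : WithLp 2 (Vec dx × Vec dy))‖ = ‖y - y'‖ := by
  rw [← sq_eq_sq₀ (norm_nonneg _) (norm_nonneg _), WithLp.prod_norm_sq_eq_of_L2]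
  simp

variable {L : ℝ≥0}

theorem HasLipschitzGradient.section_right (hg : HasLipschitzGradient L (joint g)) (x : Vec dx) :
    HasLipschitzGradient L (g x) := by
  refine ⟨fun y => (hasGradientAt_snd hg.1 x y).differentiableAt,
    LipschitzWith.of_dist_le_mul fun y y' => ?_⟩
  rw [(hasGradientAt_snd hg.1 x y).gradient, (hasGradientAt_snd hg.1 x y').gradient,
    dist_eq_norm, dist_eq_norm, ← WithLp.sub_snd, ← norm_toLp_sub_right x]
  refine (WithLp.norm_snd_le _ _).trans ?_
  simpa only [dist_eq_norm] using hg.2.dist_le_mul (WithLp.toLp 2 (x, y)) (WithLp.toLp 2 (x, y'))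

theorem norm_gradient_snd_sub_le (hg : HasLipschitzGradient L (joint g)) (x x' : Vec dx)
    (y : Vec dy) : ‖gradient (g x) y - gradient (g x') y‖ ≤ L * ‖x - x'‖ := by
  rw [(hasGradientAt_snd hg.1 x y).gradient, (hasGradientAt_snd hg.1 x' y).gradient,
    ← WithLp.sub_snd, ← norm_toLp_sub_left x x' y]
  refine (WithLp.norm_snd_le _ _).trans ?_
  simpa only [dist_eq_norm] using hg.2.dist_le_mul (WithLp.toLp 2 (x, y)) (WithLp.toLp 2 (x', y))

theorem norm_gradient_fst_sub_le (hg : HasLipschitzGradient L (joint g)) (x : Vec dx)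
    (y y' : Vec dy) :
    ‖gradient (fun x' => g x' y) x - gradient (fun x' => g x' y') x‖ ≤ L * ‖y - y'‖ := by
  rw [(hasGradientAt_fst hg.1 x y).gradient, (hasGradientAt_fst hg.1 x y').gradient,
    ← WithLp.sub_fst, ← norm_toLp_sub_right x y y']
  refine (WithLp.norm_fst_le _ _).trans ?_
  simpa only [dist_eq_norm] using hg.2.dist_le_mul (WithLp.toLp 2 (x, y)) (WithLp.toLp 2 (x, y'))

theorem norm_gradient_le_of_lipschitz {E : Type*} [NormedAddCommGroup E] [InnerProductSpace ℝ E]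
    [CompleteSpace E] {F : E → ℝ} (hF : LipschitzWith L F) (x : E) : ‖gradient F x‖ ≤ L := by
  rw [gradient, LinearIsometryEquiv.norm_map]
  exact norm_fderiv_le_of_lipschitz ℝ hF

theorem norm_gradient_snd_le (hd : Differentiable ℝ (joint f)) (hf : LipschitzWith L (joint f))
    (x : Vec dx) (y : Vec dy) : ‖gradient (f x) y‖ ≤ L := by
  rw [(hasGradientAt_snd hd x y).gradient]
  exact (WithLp.norm_snd_le _ _).trans (norm_gradient_le_of_lipschitz hf _)

theorem norm_gradient_fst_le (hd : Differentiable ℝ (joint f)) (hf : LipschitzWith L (joint f))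
    (x : Vec dx) (y : Vec dy) : ‖gradient (fun x' => f x' y) x‖ ≤ L := by
  rw [(hasGradientAt_fst hd x y).gradient]
  exact (WithLp.norm_fst_le _ _).trans (norm_gradient_le_of_lipschitz hf _)

theorem hasGradientAt_penalty {σ : ℝ} {x : Vec dx} {y : Vec dy}
    (hf : DifferentiableAt ℝ (f x) y) (hg : DifferentiableAt ℝ (g x) y) :
    HasGradientAt (penalty f g σ x) (σ • gradient (f x) y + gradient (g x) y) y := by
  rw [hasGradientAt_iff_hasFDerivAt, map_add, map_smul]
  exact (hf.hasGradientAt.hasFDerivAt.const_mul σ).add hg.hasGradientAt.hasFDerivAt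

theorem HasLipschitzGradient.penalty {Lf Lg : ℝ≥0} (hf : HasLipschitzGradient Lf (joint f))
    (hg : HasLipschitzGradient Lg (joint g)) {σ : ℝ} (hσ0 : 0 ≤ σ) (hσ1 : σ ≤ 1) :
    HasLipschitzGradient (Lf + Lg) (joint (_root_.penalty f g σ)) := by
  have h1 : ∀ p, HasGradientAt (joint (_root_.penalty f g σ))
      (σ • gradient (joint f) p + gradient (joint g) p) p := by
    intro p
    rw [hasGradientAt_iff_hasFDerivAt, map_add, map_smul]
    exact ((hf.1 p).hasGradientAt.hasFDerivAt.const_mul σ).add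
      (hg.1 p).hasGradientAt.hasFDerivAt
  refine ⟨fun p => (h1 p).differentiableAt, LipschitzWith.of_dist_le_mul fun p q => ?_⟩
  rw [(h1 p).gradient, (h1 q).gradient]
  refine (dist_add_add_le _ _ _ _).trans ?_
  rw [dist_smul₀, Real.norm_of_nonneg hσ0]
  have h2 := hf.2.dist_le_mul p q
  have h3 := hg.2.dist_le_mul p q
  have h4 : σ * dist (gradient (joint f) p) (gradient (joint f) q) ≤
      1 * dist (gradient (joint f) p) (gradient (joint f) q) :=
    mul_le_mul_of_nonneg_right hσ1 dist_nonneg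
  push_cast
  linarith

variable {μ : ℝ}

/-- All minimizers of a PL lower-level function have the same gradient in the parameter. -/
theorem gradient_fst_eq_of_isMin (hμ : 0 < μ) (hpl : ∀ x, IsPL μ (g x))
    (hg : HasLipschitzGradient L (joint g)) {x : Vec dx} {y z : Vec dy}
    (hy : g x y = ⨅ w, g x w) (hz : g x z = ⨅ w, g x w) :
    gradient (fun x' => g x' y) x = gradient (fun x' => g x' z) x := by
  have hdy : Differentiable ℝ (fun x' => g x' y) :=
    fun x' => (hasGradientAt_fst hg.1 x' y).differentiableAt
  have hdz : Differentiable ℝ (fun x' => g x' z) :=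
    fun x' => (hasGradientAt_fst hg.1 x' z).differentiableAt
  have hy0 : gradient (g x) y = 0 := by
    have hmin : IsLocalMin (g x) y :=
      Filter.Eventually.of_forall fun w => hy.le.trans ((hpl x).ciInf_le w)
    rw [gradient, hmin.fderiv_eq_zero, map_zero]
  refine ext_inner_right ℝ fun d => ?_
  -- By PL at `x + t • d`, `y` is optimal there up to the quadratic term. So `ψ ≥ 0 = ψ 0`, and its
  -- derivative at `0`, the difference of the two directional derivatives, vanishes.
  set ψ : ℝ → ℝ := fun t => g (x + t • d) z - g (x + t • d) y +
    (L * ‖d‖) ^ 2 / (2 * μ) * t ^ 2 with hψ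
  have hψd : HasDerivAt ψ (inner ℝ (gradient (fun x' => g x' z) x) d
      - inner ℝ (gradient (fun x' => g x' y) x) d) 0 := by
    have h1 := hasDerivAt_line hdz x d 0
    have h2 := hasDerivAt_line hdy x d 0
    have h3 := (hasDerivAt_pow 2 (0 : ℝ)).const_mul ((L * ‖d‖) ^ 2 / (2 * μ))
    refine ((h1.sub h2).add h3).congr_deriv ?_
    simp only [zero_smul, add_zero, Nat.cast_ofNat, mul_zero, Nat.add_one_sub_one, pow_one]
  have hmin : IsLocalMin ψ 0 := by
    refine Filter.Eventually.of_forall fun t => ?_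
    have h1 : ψ 0 = 0 := by simp [hψ, hy, hz]
    have h2 := (hpl (x + t • d)).gap_le hμ y
    have h3 := (hpl (x + t • d)).ciInf_le z
    have h4 := norm_gradient_snd_sub_le hg (x + t • d) x y
    rw [hy0, sub_zero, add_sub_cancel_left, norm_smul] at h4
    have h5 : ‖gradient (g (x + t • d)) y‖ ^ 2 / (2 * μ) ≤
        (L * ‖d‖) ^ 2 / (2 * μ) * t ^ 2 := by
      rw [div_mul_eq_mul_div]
      gcongr
      calc _ ≤ (L * (‖t‖ * ‖d‖)) ^ 2 := pow_le_pow_left₀ (norm_nonneg _) h4 2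
        _ = _ := by rw [mul_pow, mul_pow, Real.norm_eq_abs, sq_abs]; ring
    rw [h1]
    simp only [hψ]
    linarith
  have := hmin.hasDerivAt_eq_zero hψd
  linarith

/-- Move `y` and `z` to nearby minimizers, where the `x`-gradients agree. The points `y` and `z`
themselves may be far apart. -/
theorem norm_gradient_fst_sub_le_of_isPL (hμ : 0 < μ) (hpl : ∀ x, IsPL μ (g x))
    (hg : HasLipschitzGradient L (joint g)) (x : Vec dx) (y z : Vec dy) :
    μ * ‖gradient (fun x' => g x' y) x - gradient (fun x' => g x' z) x‖ ≤
      L * (‖gradient (g x) y‖ + ‖gradient (g x) z‖) := by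
  have key : ∀ θ : ℝ, 0 < θ → θ < 1 →
      θ * (μ * ‖gradient (fun x' => g x' y) x - gradient (fun x' => g x' z) x‖) ≤
      L * (‖gradient (g x) y‖ + ‖gradient (g x) z‖) := by
    intro θ hθ0 hθ1
    obtain ⟨u, hu, hyu⟩ := (hpl x).exists_isMin_dist_le hμ (hg.section_right x) hθ0 hθ1 y
    obtain ⟨w, hw, hzw⟩ := (hpl x).exists_isMin_dist_le hμ (hg.section_right x) hθ0 hθ1 z
    have h1 := norm_gradient_fst_sub_le hg x y u
    have h2 := norm_gradient_fst_sub_le hg x w z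
    have h3 := gradient_fst_eq_of_isMin hμ hpl hg hu hw
    have h4 : ‖gradient (fun x' => g x' y) x - gradient (fun x' => g x' z) x‖ ≤
        L * ‖u - y‖ + L * ‖w - z‖ := by
      rw [norm_sub_rev u y]
      refine (norm_sub_le_norm_sub_add_norm_sub _ (gradient (fun x' => g x' u) x) _).trans ?_
      rw [← h3] at h2
      linarith
    calc _ = θ * μ * ‖gradient (fun x' => g x' y) x - gradient (fun x' => g x' z) x‖ := by ring
      _ ≤ θ * μ * (L * ‖u - y‖ + L * ‖w - z‖) := by gcongr
      _ = L * (θ * μ * ‖u - y‖ + θ * μ * ‖w - z‖) := by ring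
      _ ≤ _ := by gcongr
  set a := μ * ‖gradient (fun x' => g x' y) x - gradient (fun x' => g x' z) x‖
  refine le_of_tendsto (f := fun θ : ℝ => θ * a) (x := 𝓝[<] 1) ?_
    (Filter.mem_of_superset (Ioo_mem_nhdsLT zero_lt_one) fun θ hθ => key θ hθ.1 hθ.2)
  have : Filter.Tendsto (fun θ : ℝ => θ * a) (𝓝 1) (𝓝 (1 * a)) :=
    (continuous_id.mul continuous_const).tendsto 1
  rw [one_mul] at this
  exact this.mono_left nhdsWithin_le_nhds

end Partial

/-! ### Gaps at warm starts and monotonicity of the iteration bound. -/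

section WarmStart

variable {dx dy : ℕ} {μ : ℝ} {L : ℝ≥0} {g : Vec dx → Vec dy → ℝ}

theorem gap_le_of_norm_gradient_le (hμ : 0 < μ) (hpl : ∀ x, IsPL μ (g x))
    (hg : HasLipschitzGradient L (joint g)) {x x' : Vec dx} {y : Vec dy} {δ R : ℝ}
    (hδ : ‖gradient (g x) y‖ ≤ δ) (hR : ‖x' - x‖ ≤ R) :
    g x' y - ⨅ w, g x' w ≤ (δ ^ 2 + L ^ 2 * R ^ 2) / μ := by
  have h1 := norm_gradient_snd_sub_le hg x' x y
  have h2 : ‖gradient (g x') y‖ ≤ δ + L * R := by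
    have h3 : gradient (g x') y = gradient (g x) y + (gradient (g x') y - gradient (g x) y) := by
      abel
    rw [h3]
    refine (norm_add_le _ _).trans (add_le_add hδ (h1.trans ?_))
    gcongr
  refine ((hpl x').gap_le hμ y).trans ?_
  rw [div_le_div_iff₀ (by positivity) hμ]
  have h4 : ‖gradient (g x') y‖ ^ 2 ≤ (δ + L * R) ^ 2 := pow_le_pow_left₀ (norm_nonneg _) h2 2
  -- The factor `2` in `(δ + LR)² ≤ 2(δ² + L²R²)` cancels the one in `2 * μ`.
  nlinarith [sq_nonneg (δ - L * R), mul_le_mul_of_nonneg_right h4 hμ.le,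
    mul_nonneg hμ.le (sq_nonneg (δ - L * R))]

theorem warm_gap_le {ℓ a₀ Cφ δ : ℝ} (hμ : 0 < μ) (hμℓ : μ ≤ ℓ) :
    (δ ^ 2 + ℓ ^ 2 * (Cφ / a₀) ^ 2) / μ ≤
      ℓ ^ 2 / μ ^ 3 * δ ^ 2 + ℓ ^ 4 / (μ ^ 3 * a₀ ^ 2) * Cφ ^ 2 := by
  have h1 : 1 / μ ≤ ℓ ^ 2 / μ ^ 3 := by
    rw [div_le_div_iff₀ hμ (by positivity)]
    nlinarith [mul_le_mul_of_nonneg_left (pow_le_pow_left₀ hμ.le hμℓ 2) hμ.le]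
  calc (δ ^ 2 + ℓ ^ 2 * (Cφ / a₀) ^ 2) / μ = 1 / μ * (δ ^ 2 + ℓ ^ 2 * (Cφ / a₀) ^ 2) := by ring
    _ ≤ ℓ ^ 2 / μ ^ 3 * (δ ^ 2 + ℓ ^ 2 * (Cφ / a₀) ^ 2) := by gcongr
    _ = _ := by ring

variable {α L₀ ℓ a₀ Cφ : ℝ}

/-- Provides the hypothesis `hA` of `acgmCount_le`, and positivity of the constants under the
logarithm. -/
theorem two_mul_sq_le_warmConst (hμ : 0 < μ) (hα : 1 < α) (hL₀ : 0 < L₀) (hμℓ : μ ≤ ℓ) (δ : ℝ) :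
    2 * δ ^ 2 ≤ warmConst μ α L₀ ℓ a₀ Cφ δ := by
  have h1 := one_le_prefactorC hμ hα hL₀ hμℓ
  have h2 := (div_nonneg (by positivity) hμ.le).trans
    (warm_gap_le (ℓ := ℓ) (a₀ := a₀) (Cφ := 0) (δ := δ) hμ hμℓ)
  have h3 : 1 ≤ ℓ / μ := by rwa [le_div_iff₀ hμ, one_mul]
  have hℓ : 0 < ℓ := hμ.trans_le hμℓ
  have h4 : 0 ≤ ℓ ^ 4 / (μ ^ 3 * a₀ ^ 2) * Cφ ^ 2 := by positivity
  unfold warmConst gapConst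
  calc 2 * δ ^ 2 ≤ 2 * (ℓ / μ) ^ 4 * δ ^ 2 := by
        have := one_le_pow₀ h3 (n := 4)
        gcongr
        linarith
    _ = 2 * ℓ ^ 2 / μ * 1 * (ℓ ^ 2 / μ ^ 3 * δ ^ 2) := by field_simp
    _ ≤ _ := by
        gcongr
        linarith

theorem warmConst_le (hμ : 0 < μ) (hα : 1 < α) (hL₀ : 0 < L₀) (hμℓ : μ ≤ ℓ) {δ : ℝ}
    (hδ0 : 0 ≤ δ) (hδ1 : δ ≤ 1) :
    warmConst μ α L₀ ℓ a₀ Cφ δ ≤ warmConst μ α L₀ ℓ a₀ Cφ 1 := by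
  refine gapConst_mono hμ hα hL₀ hμℓ ?_
  gcongr

theorem iterBound_mono {A B δ p : ℝ} (hA : 0 < A) (hAB : A ≤ B) (hδ : 0 < δ) (hp0 : 0 < p)
    (hp1 : p < 1) : iterBound A δ p ≤ iterBound B δ p := by
  have hr : 1 < 1 / (1 - p) := by rw [lt_div_iff₀] <;> linarith
  have := Real.log_pos hr
  unfold iterBound
  gcongr

theorem iterBound_sq_le {B ε p : ℝ} (hB : 0 < B) (hε0 : 0 < ε) (hε1 : ε ≤ Real.exp (-1))
    (hp0 : 0 < p) (hp1 : p < 1) :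
    iterBound B (ε ^ 2) p ≤ (|Real.log B| + 4) / Real.log (1 / (1 - p)) * |Real.log ε| := by
  have hr : 1 < 1 / (1 - p) := by rw [lt_div_iff₀] <;> linarith
  have hr0 := Real.log_pos hr
  have h1 : Real.log ε ≤ -1 := by
    rw [← Real.log_exp (-1)]
    exact Real.log_le_log hε0 hε1
  unfold iterBound
  rw [div_mul_eq_mul_div, abs_of_nonpos (by linarith : Real.log ε ≤ 0)]
  gcongr
  rw [Real.log_div hB.ne' (by positivity), ← pow_mul, Real.log_pow]
  push_cast
  -- `log (B / ε⁴) = log B + 4 |log ε|`, and `|log ε| ≥ 1` absorbs `log B`.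
  nlinarith [le_abs_self (Real.log B), abs_nonneg (Real.log B)]

end WarmStart

/-! ### The outer iteration and the final counts. -/

section Outer

variable {dx dy : ℕ} {f g : Vec dx → Vec dy → ℝ} {μ σbar : ℝ} {lf Lf Lg ρf ρg : ℝ≥0}

namespace BilevelAssumption

theorem lower_pl (hfg : BilevelAssumption f g μ σbar lf Lf Lg ρf ρg)
    (hσ : 0 < σbar) (x : Vec dx) : IsPL μ (g x) := by
  have h := hfg.pl 0 le_rfl hσ.le x
  have h0 : penalty f g 0 x = g x := by ext y; simp [penalty]
  rwa [h0] at h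

theorem mu_le (hfg : BilevelAssumption f g μ σbar lf Lf Lg ρf ρg)
    (hσ : 0 < σbar) (hne : ∃ x y y', g x y ≠ g x y') : μ ≤ Lg := by
  obtain ⟨x, hx⟩ := hne
  exact (hfg.lower_pl hσ x).le_of_not_const (hfg.g_gradient.section_right x) hx

theorem norm_gradient_lower_le (hfg : BilevelAssumption f g μ σbar lf Lf Lg ρf ρg)
    {ε : ℝ} (hε : 0 < ε) (x : Vec dx) (y : Vec dy) :
    ‖gradient (g x) y‖ ≤ ‖gradient (penalty f g ε x) y‖ + ε * lf := by
  have h1 := (hasGradientAt_penalty (σ := ε) ((hfg.f_gradient.section_right x).1 y)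
    ((hfg.g_gradient.section_right x).1 y)).gradient
  have h2 : gradient (g x) y = gradient (penalty f g ε x) y - ε • gradient (f x) y := by
    rw [h1]; abel
  rw [h2]
  refine (norm_sub_le _ _).trans ?_
  rw [norm_smul, Real.norm_of_nonneg hε.le]
  gcongr
  exact norm_gradient_snd_le hfg.f_gradient.1 hfg.f_lipschitz x y

theorem norm_gradient_penalty_le (hfg : BilevelAssumption f g μ σbar lf Lf Lg ρf ρg)
    {ε : ℝ} (hε : 0 ≤ ε) (hε1 : ε ≤ 1) (x : Vec dx) (y : Vec dy) :
    ‖gradient (penalty f g ε x) y‖ ≤ lf + ‖gradient (g x) y‖ := by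
  rw [(hasGradientAt_penalty (σ := ε) ((hfg.f_gradient.section_right x).1 y)
    ((hfg.g_gradient.section_right x).1 y)).gradient]
  refine (norm_add_le _ _).trans ?_
  rw [norm_smul, Real.norm_of_nonneg hε]
  gcongr
  have h1 := norm_gradient_snd_le hfg.f_gradient.1 hfg.f_lipschitz x y
  nlinarith [norm_nonneg (gradient (f x) y)]

/-- At an approximate minimizer of the penalty function, `‖∇_y g‖ ≤ ε² + ε lf`, so dividing the
difference of `x`-gradients by `σ = ε` leaves at most `Lg (2ε + lf) / μ`. The terms `Cs` and `Lf /
μ` of `hypergradC` are slack. -/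
theorem norm_approxHypergradient_le (hfg : BilevelAssumption f g μ σbar lf Lf Lg ρf ρg)
    (hμ : 0 < μ) (hσ : 0 < σbar) {ε Cs : ℝ} (hε : 0 < ε)
    (hε1 : ε ≤ 1) (hCs : 0 ≤ Cs) {x : Vec dx} {y z : Vec dy}
    (hy : ‖gradient (penalty f g ε x) y‖ ≤ ε ^ 2) (hz : ‖gradient (g x) z‖ ≤ ε ^ 2) :
    ‖approxHypergradient f g ε x y z‖ ≤ hypergradC μ lf Lf Lg Cs := by
  have h1 := norm_gradient_fst_sub_le_of_isPL hμ (hfg.lower_pl hσ) hfg.g_gradient x y z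
  have h2 := hfg.norm_gradient_lower_le hε x y
  unfold approxHypergradient hypergradC
  refine (norm_add_le _ _).trans ?_
  have h3 := norm_gradient_fst_le hfg.f_gradient.1 hfg.f_lipschitz x y
  rw [norm_smul, Real.norm_of_nonneg (by positivity : 0 ≤ 1 / ε)]
  set N := ‖gradient (fun x' => g x' y) x - gradient (fun x' => g x' z) x‖
  have h4 : μ * N ≤ Lg * (2 * ε ^ 2 + ε * lf) := by
    exact h1.trans (mul_le_mul_of_nonneg_left (by linarith) Lg.coe_nonneg)
  have h5 : 1 / ε * N ≤ Lg * (2 + lf) / μ := by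
    rw [le_div_iff₀ hμ, div_mul_eq_mul_div, one_mul, div_mul_eq_mul_div, div_le_iff₀ hε]
    calc N * μ ≤ Lg * (2 * ε ^ 2 + ε * lf) := by linarith
      _ ≤ Lg * (2 * ε + ε * lf) := by
        gcongr
        nlinarith
      _ = _ := by ring
  have h6 : (Lg * (2 + lf) / μ : ℝ) = Lg * lf / μ + 2 * (Lg / μ) := by ring
  have h7 : (0 : ℝ) ≤ Lf / μ := by positivity
  linarith

end BilevelAssumption

theorem a₀_le_outerState_a (D : AlgData dx dy) (ε : ℝ) (t : ℕ) :
    D.a₀ ≤ (outerState f g D ε t).a := by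
  induction t with
  | zero => exact le_rfl
  | succ t ih =>
    refine ih.trans (Real.le_sqrt_of_sq_le ?_)
    exact le_add_of_nonneg_right (sq_nonneg _)

theorem norm_outerState_x_sub_le (D : AlgData dx dy) {ε B : ℝ} (t : ℕ)
    (hB : ‖approxHypergradient f g ε (outerState f g D ε t).x (outerState f g D ε (t + 1)).y
      (outerState f g D ε (t + 1)).z‖ ≤ B) :
    ‖(outerState f g D ε (t + 1)).x - (outerState f g D ε t).x‖ ≤ B / D.a₀ := by
  have ha := a₀_le_outerState_a (f := f) (g := g) D ε (t + 1)
  have ha0 : 0 < (outerState f g D ε (t + 1)).a := D.a₀_pos.trans_le ha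
  have h1 : (outerState f g D ε (t + 1)).x - (outerState f g D ε t).x =
      -((1 / (outerState f g D ε (t + 1)).a) • approxHypergradient f g ε (outerState f g D ε t).x
        (outerState f g D ε (t + 1)).y (outerState f g D ε (t + 1)).z) := by
    rw [sub_eq_iff_eq_add, neg_add_eq_sub]
    rfl
  rw [h1, norm_neg, norm_smul, Real.norm_of_nonneg (by positivity), div_mul_eq_mul_div, one_mul]
  have hB0 := (norm_nonneg _).trans hB
  have := D.a₀_pos
  gcongr

namespace BilevelAssumption

theorem norm_gradient_outerState_le (hfg : BilevelAssumption f g μ σbar lf Lf Lg ρf ρg)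
    (hμ : 0 < μ) (hσ : 0 < σbar) (hμL : μ ≤ Lg)
    (D : AlgData dx dy) {ε : ℝ} (hε : 0 < ε) (hε1 : ε ≤ 1) (hεσ : ε ≤ σbar) (t : ℕ) :
    ‖gradient (g (outerState f g D ε t).x) (outerState f g D ε (t + 1)).z‖ ≤ ε ^ 2 ∧
    ‖gradient (penalty f g ε (outerState f g D ε t).x) (outerState f g D ε (t + 1)).y‖
      ≤ ε ^ 2 := by
  have hμL' : μ ≤ ((Lf + Lg : ℝ≥0) : ℝ) := by
    push_cast
    linarith [Lf.coe_nonneg]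
  exact ⟨norm_gradient_acgmOut_le hμ D.one_lt_α D.L₁_pos (hfg.lower_pl hσ _)
      (hfg.g_gradient.section_right _) hμL _ (by positivity),
    norm_gradient_acgmOut_le hμ D.one_lt_α D.L₂_pos (hfg.pl ε hε.le hεσ _)
      ((hfg.f_gradient.penalty hfg.g_gradient hε.le hε1).section_right _) hμL' _ (by positivity)⟩

/-- The iteration counts for a fixed tolerance. -/
theorem inner_counts_le (hfg : BilevelAssumption f g μ σbar lf Lf Lg ρf ρg)
    (hμ : 0 < μ) (hσ : 0 < σbar) (hμL : μ ≤ Lg) (D : AlgData dx dy)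
    {ε Cs : ℝ} (hε : 0 < ε) (hε1 : ε ≤ 1) (hεσ : ε ≤ σbar) (hCs : 0 ≤ Cs) :
    let Cφ := hypergradC μ lf Lf Lg Cs
    let Cb := warmConst μ D.α D.L₁ Lg D.a₀ Cφ (ε ^ 2)
    let Cc := warmConst μ D.α D.L₂ (Lf + Lg) D.a₀ Cφ (ε ^ 2)
    (∀ t : ℕ, IsLeast (lowerStop f g D ε t) (lowerCount f g D ε t) ∧
      IsLeast (penaltyStop f g D ε t) (penaltyCount f g D ε t)) ∧
    (∀ t : ℕ, 1 ≤ t →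
      (lowerCount f g D ε t : ℝ) ≤ iterBound Cb (ε ^ 2) (rateP μ D.α D.L₁ Lg) ∧
      (penaltyCount f g D ε t : ℝ) ≤ iterBound Cc (ε ^ 2) (rateP μ D.α D.L₂ (Lf + Lg))) ∧
    (lowerCount f g D ε 0 : ℝ) ≤
      iterBound (max Cb (gapConst μ D.α D.L₁ Lg (g D.x₀ D.z₀ - ⨅ y, g D.x₀ y))) (ε ^ 2)
        (rateP μ D.α D.L₁ Lg) ∧
    (penaltyCount f g D ε 0 : ℝ) ≤
      iterBound (max Cc (gapConst μ D.α D.L₂ (Lf + Lg)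
        (penalty f g ε D.x₀ D.y₀ - ⨅ y, penalty f g ε D.x₀ y))) (ε ^ 2)
        (rateP μ D.α D.L₂ (Lf + Lg)) := by
  intro Cφ Cb Cc
  have hLpen := hfg.f_gradient.penalty hfg.g_gradient hε.le hε1
  have hμL' : μ ≤ ((Lf + Lg : ℝ≥0) : ℝ) := by
    push_cast
    linarith [Lf.coe_nonneg]
  have hδ : 0 < ε ^ 2 := by positivity
  have hCb : 2 * (ε ^ 2) ^ 2 ≤ Cb := two_mul_sq_le_warmConst hμ D.one_lt_α D.L₁_pos hμL _
  have hCc : 2 * (ε ^ 2) ^ 2 ≤ Cc := two_mul_sq_le_warmConst hμ D.one_lt_α D.L₂_pos hμL' _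
  have hz := fun x => hfg.lower_pl hσ x
  have hy := hfg.pl ε hε.le hεσ
  refine ⟨fun t => ⟨acgmCount_isLeast hμ D.one_lt_α D.L₁_pos (hz _)
      (hfg.g_gradient.section_right _) hμL _ hδ,
    acgmCount_isLeast hμ D.one_lt_α D.L₂_pos (hy _) (hLpen.section_right _) hμL' _ hδ⟩, ?_, ?_, ?_⟩
  · intro t ht
    obtain ⟨t, rfl⟩ := Nat.exists_eq_succ_of_ne_zero (Nat.one_le_iff_ne_zero.1 ht)
    -- The state at `t + 1` stores the points returned in iteration `t`, which are the new starting
    -- points.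
    obtain ⟨hgz, hgy⟩ := hfg.norm_gradient_outerState_le hμ hσ hμL D hε hε1 hεσ t
    have hv := hfg.norm_approxHypergradient_le hμ hσ hε hε1 hCs hgy hgz
    have hR := norm_outerState_x_sub_le D t hv
    constructor
    · refine acgmCount_le hμ D.one_lt_α D.L₁_pos (hz _) (hfg.g_gradient.section_right _) hμL _ hδ
        hCb (gapConst_mono hμ D.one_lt_α D.L₁_pos hμL ?_)
      exact (gap_le_of_norm_gradient_le hμ hz hfg.g_gradient hgz hR).trans (warm_gap_le hμ hμL)
    · refine acgmCount_le hμ D.one_lt_α D.L₂_pos (hy _) (hLpen.section_right _) hμL' _ hδ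
        hCc (gapConst_mono hμ D.one_lt_α D.L₂_pos hμL' ?_)
      exact (gap_le_of_norm_gradient_le hμ hy hLpen hgy hR).trans (warm_gap_le hμ hμL')
  · exact acgmCount_le hμ D.one_lt_α D.L₁_pos (hz _) (hfg.g_gradient.section_right _) hμL _ hδ
      (hCb.trans (le_max_left _ _)) (le_max_right _ _)
  · exact acgmCount_le hμ D.one_lt_α D.L₂_pos (hy _) (hLpen.section_right _) hμL' _ hδ
      (hCc.trans (le_max_left _ _)) (le_max_right _ _)

theorem exists_inner_counts_le_log (hfg : BilevelAssumption f g μ σbar lf Lf Lg ρf ρg)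
    (hμ : 0 < μ) (hσ : 0 < σbar) (hμL : μ ≤ Lg)
    (D : AlgData dx dy) :
    ∃ C : ℝ, ∀ᶠ ε in 𝓝[>] (0 : ℝ), ∀ t : ℕ,
      (lowerCount f g D ε t : ℝ) ≤ C * |Real.log ε| ∧
      (penaltyCount f g D ε t : ℝ) ≤ C * |Real.log ε| := by
  have hμL' : μ ≤ (Lf + Lg : ℝ) := by linarith [Lf.coe_nonneg]
  have hp0 := rateP_pos (L := Lg) hμ D.one_lt_α D.L₁_pos
  have hp1 : rateP μ D.α D.L₁ Lg < 1 :=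
    (rateP_le (L₀ := D.L₁) hμ D.one_lt_α hμL).trans_lt (by norm_num)
  have hq0 := rateP_pos (L := (Lf + Lg : ℝ)) hμ D.one_lt_α D.L₂_pos
  have hq1 : rateP μ D.α D.L₂ (Lf + Lg) < 1 :=
    (rateP_le (L₀ := D.L₂) hμ D.one_lt_α hμL').trans_lt (by norm_num)
  set Cφ := hypergradC μ lf Lf Lg 0 with hCφ
  set Bz := max (warmConst μ D.α D.L₁ Lg D.a₀ Cφ 1)
    (gapConst μ D.α D.L₁ Lg (g D.x₀ D.z₀ - ⨅ y, g D.x₀ y)) with hBz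
  -- The initial penalty gap depends on `ε`; PL bounds it by the squared gradient at `y₀`, which is
  -- bounded uniformly for `ε ≤ 1`. Likewise the tolerance in `warmConst` is replaced by `1`.
  set By := max (warmConst μ D.α D.L₂ (Lf + Lg) D.a₀ Cφ 1)
    (gapConst μ D.α D.L₂ (Lf + Lg) ((lf + ‖gradient (g D.x₀) D.y₀‖) ^ 2 / (2 * μ))) with hBy
  set C₁ := (|Real.log Bz| + 4) / Real.log (1 / (1 - rateP μ D.α D.L₁ Lg))
  set C₂ := (|Real.log By| + 4) / Real.log (1 / (1 - rateP μ D.α D.L₂ (Lf + Lg)))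
  refine ⟨max C₁ C₂, ?_⟩
  have hmin : 0 < min (min 1 σbar) (Real.exp (-1)) :=
    lt_min (lt_min one_pos hσ) (Real.exp_pos _)
  filter_upwards [Ioo_mem_nhdsGT hmin] with ε hε t
  have hε0 : 0 < ε := hε.1
  have hεe : ε ≤ Real.exp (-1) := hε.2.le.trans (min_le_right _ _)
  have hε1 : ε ≤ 1 := hε.2.le.trans ((min_le_left _ _).trans (min_le_left _ _))
  have hεσ : ε ≤ σbar := hε.2.le.trans ((min_le_left _ _).trans (min_le_right _ _))
  have hδ : 0 < ε ^ 2 := by positivity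
  have hδ1 : ε ^ 2 ≤ 1 := pow_le_one₀ hε0.le hε1
  obtain ⟨-, ht, hz0, hy0⟩ := hfg.inner_counts_le hμ hσ hμL D hε0 hε1 hεσ le_rfl
  rw [← hCφ] at ht hz0 hy0
  have hCb0 : 0 < warmConst μ D.α D.L₁ Lg D.a₀ Cφ (ε ^ 2) :=
    lt_of_lt_of_le (by positivity) (two_mul_sq_le_warmConst hμ D.one_lt_α D.L₁_pos hμL (ε ^ 2))
  have hCc0 : 0 < warmConst μ D.α D.L₂ (Lf + Lg) D.a₀ Cφ (ε ^ 2) :=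
    lt_of_lt_of_le (by positivity) (two_mul_sq_le_warmConst hμ D.one_lt_α D.L₂_pos hμL' (ε ^ 2))
  have hCb := warmConst_le (a₀ := D.a₀) (Cφ := Cφ) hμ D.one_lt_α D.L₁_pos hμL hδ.le hδ1
  have hCc := warmConst_le (a₀ := D.a₀) (Cφ := Cφ) hμ D.one_lt_α D.L₂_pos hμL' hδ.le hδ1
  have hBz0 : 0 < Bz := hCb0.trans_le (hCb.trans (le_max_left _ _))
  have hBy0 : 0 < By := hCc0.trans_le (hCc.trans (le_max_left _ _))
  have hgap : penalty f g ε D.x₀ D.y₀ - ⨅ y, penalty f g ε D.x₀ y ≤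
      (lf + ‖gradient (g D.x₀) D.y₀‖) ^ 2 / (2 * μ) := by
    refine ((hfg.pl ε hε0.le hεσ D.x₀).gap_le hμ D.y₀).trans ?_
    gcongr
    exact hfg.norm_gradient_penalty_le hε0.le hε1 _ _
  have hz : (lowerCount f g D ε t : ℝ) ≤ iterBound Bz (ε ^ 2) (rateP μ D.α D.L₁ Lg) := by
    rcases Nat.eq_zero_or_pos t with rfl | h
    · exact hz0.trans (iterBound_mono (lt_max_of_lt_left hCb0)
        (max_le_max hCb le_rfl) hδ hp0 hp1)
    · exact (ht t h).1.trans (iterBound_mono hCb0 (hCb.trans (le_max_left _ _)) hδ hp0 hp1)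
  have hy : (penaltyCount f g D ε t : ℝ) ≤
      iterBound By (ε ^ 2) (rateP μ D.α D.L₂ (Lf + Lg)) := by
    rcases Nat.eq_zero_or_pos t with rfl | h
    · exact hy0.trans (iterBound_mono (lt_max_of_lt_left hCc0)
        (max_le_max hCc (gapConst_mono hμ D.one_lt_α D.L₂_pos hμL' hgap)) hδ hq0 hq1)
    · exact (ht t h).2.trans (iterBound_mono hCc0 (hCc.trans (le_max_left _ _)) hδ hq0 hq1)
  have hlog := abs_nonneg (Real.log ε)
  exact ⟨(hz.trans (iterBound_sq_le hBz0 hε0 hεe hp0 hp1)).trans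
      (mul_le_mul_of_nonneg_right (le_max_left _ _) hlog),
    (hy.trans (iterBound_sq_le hBy0 hε0 hεe hq0 hq1)).trans
      (mul_le_mul_of_nonneg_right (le_max_right _ _) hlog)⟩

end BilevelAssumption

end Outer

theorem proposition3 {dx dy : ℕ} (f g : Vec dx → Vec dy → ℝ) (μ σbar : ℝ)
    (lf Lf Lg ρf ρg : ℝ≥0) (hμ : 0 < μ) (hσbar : 0 < σbar)
    (hfg : BilevelAssumption f g μ σbar lf Lf Lg ρf ρg)
    (hne : ∃ x y y', g x y ≠ g x y')
    (D : AlgData dx dy) :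
    let pg := rateP μ D.α D.L₁ Lg
    let pσ := rateP μ D.α D.L₂ (Lf + Lg)
    (0 < pg ∧ pg < 1 ∧ 0 < pσ ∧ pσ < 1) ∧
    (∀ Cs : ℝ, 0 ≤ Cs → ∀ ε : ℝ, 0 < ε → ε ≤ 1 → ε ≤ σbar → ε * ρf ≤ ρg →
      let Cφ := hypergradC μ lf Lf Lg Cs
      let Cb := warmConst μ D.α D.L₁ Lg D.a₀ Cφ (ε ^ 2)
      let Cc := warmConst μ D.α D.L₂ (Lf + Lg) D.a₀ Cφ (ε ^ 2)
      let Δz := g D.x₀ D.z₀ - ⨅ y, g D.x₀ y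
      let Δy := penalty f g ε D.x₀ D.y₀ - ⨅ y, penalty f g ε D.x₀ y
      (∀ t : ℕ, IsLeast (lowerStop f g D ε t) (lowerCount f g D ε t) ∧
        IsLeast (penaltyStop f g D ε t) (penaltyCount f g D ε t)) ∧
      (∀ t : ℕ, 1 ≤ t →
        (lowerCount f g D ε t : ℝ) ≤ iterBound Cb (ε ^ 2) pg ∧
        (penaltyCount f g D ε t : ℝ) ≤ iterBound Cc (ε ^ 2) pσ) ∧
      (lowerCount f g D ε 0 : ℝ) ≤
        iterBound (max Cb (gapConst μ D.α D.L₁ Lg Δz)) (ε ^ 2) pg ∧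
      (penaltyCount f g D ε 0 : ℝ) ≤
        iterBound (max Cc (gapConst μ D.α D.L₂ (Lf + Lg) Δy)) (ε ^ 2) pσ) ∧
    ∃ C : ℝ, ∀ᶠ ε in 𝓝[>] (0 : ℝ), ∀ t : ℕ,
      (lowerCount f g D ε t : ℝ) ≤ C * |Real.log ε| ∧
      (penaltyCount f g D ε t : ℝ) ≤ C * |Real.log ε| := by
  intro pg pσ
  have hμL : μ ≤ Lg := hfg.mu_le hσbar hne
  have hμL' : μ ≤ (Lf + Lg : ℝ) := by linarith [Lf.coe_nonneg]
  refine ⟨⟨rateP_pos hμ D.one_lt_α D.L₁_pos,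
    (rateP_le hμ D.one_lt_α hμL).trans_lt (by norm_num),
    rateP_pos hμ D.one_lt_α D.L₂_pos,
    (rateP_le hμ D.one_lt_α hμL').trans_lt (by norm_num)⟩, ?_,
    hfg.exists_inner_counts_le_log hμ hσbar hμL D⟩
  intro Cs hCs ε hε hε1 hεσ _
  exact hfg.inner_counts_le hμ hσbar hμL D hε hε1 hεσ hCs
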